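/- Let $H$ be a real or complex Hilbert space, with inner product $\langle\cdot,\cdot\rangle$ linear in its first argument. Suppose that (i) the operator $A$ generates a $C_0$-semigroup of contractions $(S(t))_{t\ge 0}$ on $H$, (ii) $B$ is a bounded linear operator on $H$, and (iii) there exist $\delta,T>0$ such that $$\int_0^T |\langle BS(t)y,S(t)y\rangle|\,dt\ \ge\ \delta\|y\|^2\qquad\text{for all } y\in H .$$ Let $r\in(-\infty,2)$ and consider the bilinear system $$\text{(BLS)}\qquad \dot z(t)=Az(t)+v(t)Bz(t),\quad z(0)=z_0\in H,$$ closed with the feedback control $$v_r(t)=-\frac{\langle z(t),Bz(t)\rangle}{\|z(t)\|^{r}}\ \text{ if } z(t)\neq 0,\qquad v_r(t)=0\ \text{ if } z(t)=0 .$$ Then $v_r$ strongly stabilizes (BLS), that is: for every $z_0\in H$ the closed-loop system has a unique global mild solution, i.e. a unique continuous $z:[0,\infty)\to H$ with $z(t)=S(t)z_0+\int_0^t v_r(s)S(t-s)Bz(s)\,ds$ for all $t\ge0$; the equilibrium $0$ is Lyapunov stable (for every $\varepsilon>0$ there is $\alpha>0$ such that $\|z_0\|<\alpha$ implies $\|z(t)\|<\varepsilon$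 for all $t\ge 0$); and $\|z(t)\|\to0$ as $t\to+\infty$ for every $z_0\in H$. Moreover, for every $z_0\in H$, the solution satisfies $$\|z(t)\|=O\big(t^{-\frac{1}{2-r}}\big)\qquad\text{as } t\to+\infty .$$ -/

import Mathlib

open Set Filter Topology MeasureTheory Asymptotics

noncomputable section

section Semigroup

variable {𝕜 H : Type*} [RCLike 𝕜] [NormedAddCommGroup H] [InnerProductSpace 𝕜 H]

/-- `(S t)_{t ≥ 0}` is a strongly continuous (C₀) semigroup of bounded operators on `H`.
Only the values of `S` at times `t ≥ 0` matter. -/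
structure IsC0Semigroup (S : ℝ → H →L[𝕜] H) : Prop where
  map_zero : S 0 = ContinuousLinearMap.id 𝕜 H
  map_add : ∀ s t : ℝ, 0 ≤ s → 0 ≤ t → S (s + t) = (S s).comp (S t)
  tendsto_zero : ∀ y : H, Tendsto (fun t : ℝ => S t y) (𝓝[>] 0) (𝓝 y)

/-- A C₀-semigroup of contractions: `‖S t y‖ ≤ ‖y‖` for all `t ≥ 0`. -/
structure IsContractionSemigroup (S : ℝ → H →L[𝕜] H) : Prop extends IsC0Semigroup S where
  norm_le : ∀ t : ℝ, 0 ≤ t → ∀ y : H, ‖S t y‖ ≤ ‖y‖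

/-- The (in general unbounded) operator `A`, with domain `D(A)`, is the infinitesimal generator
of `S`: one has `y ∈ D(A)` and `A y = w` exactly when `(S h y - y) / h → w` as `h → 0⁺`. -/
def IsGenerator (A : H →ₗ.[𝕜] H) (S : ℝ → H →L[𝕜] H) : Prop :=
  ∀ y w : H, (y, w) ∈ A.graph ↔
    Tendsto (fun h : ℝ => ((h : 𝕜)⁻¹) • (S h y - y)) (𝓝[>] 0) (𝓝 w)

end Semigroup

section Evolution

-- A real normed space structure on `H` is unique (and so is the one underlying the `𝕜`-structure);
-- it is only there to let the integrals of `H`-valued functions be written.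
variable {𝕜 H : Type*} [RCLike 𝕜] [NormedAddCommGroup H] [InnerProductSpace 𝕜 H]
  [NormedSpace ℝ H]

/-- `z` is a global mild solution on `[0, ∞)` of `z' = A z + F(t, z)`, `z(0) = z₀`, where `S` is
the semigroup generated by `A`: `z` is continuous on `[0, ∞)` and
`z(t) = S(t) z₀ + ∫₀ᵗ S(t - s) F(s, z(s)) ds` for all `t ≥ 0`, with integrable integrand. -/
structure IsMildSolution (S : ℝ → H →L[𝕜] H) (F : ℝ → H → H) (z₀ : H) (z : ℝ → H) : Prop where
  continuousOn : ContinuousOn z (Ici 0)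
  integrable : ∀ t : ℝ, 0 ≤ t →
    IntervalIntegrable (fun s : ℝ => S (t - s) (F s (z s))) volume 0 t
  eq : ∀ t : ℝ, 0 ≤ t → z t = S t z₀ + ∫ s in (0 : ℝ)..t, S (t - s) (F s (z s))

/-- The equation `z' = A z + F(t, z)` is strongly stable at the origin: every initial state has a
unique global mild solution, the equilibrium `0` is Lyapunov stable, and every solution tends to
`0` in norm. -/
structure IsStronglyStable (S : ℝ → H →L[𝕜] H) (F : ℝ → H → H) : Prop where
  existence : ∀ z₀ : H, ∃ z : ℝ → H, IsMildSolution S F z₀ z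
  uniqueness : ∀ (z₀ : H) (z w : ℝ → H), IsMildSolution S F z₀ z → IsMildSolution S F z₀ w →
    EqOn z w (Ici 0)
  lyapunov : ∀ ε : ℝ, 0 < ε → ∃ α : ℝ, 0 < α ∧ ∀ (z₀ : H) (z : ℝ → H), IsMildSolution S F z₀ z →
    ‖z₀‖ < α → ∀ t : ℝ, 0 ≤ t → ‖z t‖ < ε
  attractive : ∀ (z₀ : H) (z : ℝ → H), IsMildSolution S F z₀ z → Tendsto z atTop (𝓝 0)

/-- The right-hand side `F(t, y) = V(y) B y` obtained by closing the bilinear system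
`z' = A z + v(t) B z` with the feedback `v(t) = V(z(t))`. -/
def closedLoop (B : H →L[𝕜] H) (V : H → 𝕜) : ℝ → H → H :=
  fun _ y => V y • B y

/-- The feedback `v(t) = V(z(t))` strongly stabilizes the bilinear system `z' = A z + v(t) B z`. -/
def StronglyStabilizes (S : ℝ → H →L[𝕜] H) (B : H →L[𝕜] H) (V : H → 𝕜) : Prop :=
  IsStronglyStable S (closedLoop B V)

/-- The feedback law `y ↦ -⟨y, B y⟩ / ‖y‖ ^ r` for `y ≠ 0`, and `0` for `y = 0`. Here `⟨·, ·⟩` is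
linear in its first argument, so that `⟨y, B y⟩` is `inner 𝕜 (B y) y` in Mathlib, whose inner
product is linear in the second one. -/
def feedback (B : H →L[𝕜] H) (r : ℝ) (y : H) : 𝕜 :=
  open Classical in
  if y = 0 then 0 else -(inner 𝕜 (B y) y / ((‖y‖ ^ r : ℝ) : 𝕜))

end Evolution

end

noncomputable section

/-! ### Mild solutions with a continuous forcing term: restart, energy inequality, Gronwall. -/

section ForcedEvolution

variable {𝕜 H : Type*} [RCLike 𝕜] [NormedAddCommGroup H] [InnerProductSpace 𝕜 H]
  {S : ℝ → H →L[𝕜] H}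

/-! Write `b(y) = ⟨By, y⟩`. The closed-loop field `F(y) = -‖y‖^(-r) b(y) By` is homogeneous of
degree `3 - r > 1`, hence Lipschitz on balls (`norm_closedLoop_feedback_sub_le`), and `Re ⟨y, F(y)⟩
= -D(y)` with `D(y) = ‖y‖^(-r) |b(y)|²`. A mild solution need not be differentiable, but Duhamel's
formula and contractivity still give `‖z(t)‖² ≤ ‖z(s)‖² - 2 ∫ D(z)` over `[s, t]`
(`IsForcedSolution.energy_le`). So norms decrease: this yields Lyapunov stability, and global
existence by solving a truncated, globally Lipschitz equation whose solution never leaves the ball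
where truncation is invisible. Uniqueness is Gronwall's inequality.

For decay, fix `s` and put `M = ‖z(s)‖`. On `[s, s + T]` the orbit differs from the free orbit `S(t
- s) z(s)` by at most `∫ ‖F(z)‖`, so observability bounds `δ M²` by integrals of `|b(z)|` and `M
‖F(z)‖`. Each integrand is at most `ε M² + C M^(r-2) D(z)`; with `ε` small the first terms are
absorbed, giving `M^(4-r) ≤ C' ∫ D(z)`. With the energy inequality, `E = ‖z‖²` satisfies `E(s + T) ≤
E(s) - c E(s)^(1+a)`, `a = (2 - r)/2`. Then `E(nT)^(-a)` grows at least linearly in `n` unless `E`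
vanishes, which is the stated rate; attraction to `0` follows from it. -/

theorem IsContractionSemigroup.norm_sub_le (hS : IsContractionSemigroup S) {s t : ℝ}
    (hs : 0 ≤ s) (hst : s ≤ t) (y : H) : ‖S t y - S s y‖ ≤ ‖S (t - s) y - y‖ := by
  have h : S t y = S s (S (t - s) y) := by
    have := hS.map_add s (t - s) hs (by linarith)
    rw [← ContinuousLinearMap.comp_apply, ← this]; congr 2; ring
  rw [h, ← map_sub]
  exact hS.norm_le s hs _

/-- Freezing time at `0` for negative arguments makes every Duhamel integrand continuous on the
whole line, so integrability is automatic. -/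
theorem IsContractionSemigroup.continuous_max (hS : IsContractionSemigroup S) (y : H) :
    Continuous fun t : ℝ => S (max t 0) y := by
  have h0 : ContinuousWithinAt (fun t : ℝ => S t y) (Ici 0) 0 := by
    rw [← continuousWithinAt_Ioi_iff_Ici]
    simpa [ContinuousWithinAt, hS.map_zero] using hS.tendsto_zero y
  rw [Metric.continuousWithinAt_iff] at h0
  have key : ∀ ε > 0, ∃ d > 0, ∀ s t : ℝ, 0 ≤ s → s ≤ t → t - s < d → ‖S t y - S s y‖ < ε := by
    intro ε hε
    obtain ⟨d, hd, h⟩ := h0 ε hε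
    refine ⟨d, hd, fun s t hs hst htd => (hS.norm_sub_le hs hst y).trans_lt ?_⟩
    have := @h (t - s) (by simpa using hst)
      (by rw [dist_zero_right, Real.norm_eq_abs, abs_of_nonneg (by linarith)]; exact htd)
    simpa [hS.map_zero, dist_eq_norm] using this
  rw [Metric.continuous_iff]
  intro t ε hε
  obtain ⟨d, hd, h⟩ := key ε hε
  refine ⟨d, hd, fun s hs => ?_⟩
  have hm : |max s 0 - max t 0| < d :=
    (abs_max_sub_max_le_abs s t 0).trans_lt (by simpa [Real.dist_eq] using hs)
  rw [abs_lt] at hm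
  rcases le_total (max s 0) (max t 0) with hle | hle
  · rw [dist_comm, dist_eq_norm]
    exact h _ _ (le_max_right _ _) hle (by linarith [hm.1])
  · rw [dist_eq_norm]
    exact h _ _ (le_max_right _ _) hle (by linarith [hm.2])

theorem IsContractionSemigroup.continuous_max_uncurry (hS : IsContractionSemigroup S) :
    Continuous fun p : ℝ × H => S (max p.1 0) p.2 := by
  rw [continuous_iff_continuousAt]
  rintro ⟨t, y⟩
  have h1 : Tendsto (fun p : ℝ × H => S (max p.1 0) y) (𝓝 (t, y)) (𝓝 (S (max t 0) y)) :=
    ((hS.continuous_max y).comp continuous_fst).continuousAt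
  have h2 : Tendsto (fun p : ℝ × H => S (max p.1 0) (p.2 - y)) (𝓝 (t, y)) (𝓝 0) := by
    apply squeeze_zero_norm (fun p => hS.norm_le _ (le_max_right _ _) _)
    have : Continuous fun p : ℝ × H => ‖p.2 - y‖ := by fun_prop
    simpa using this.tendsto (t, y)
  have := h1.add h2
  simpa [ContinuousAt] using this

theorem IsContractionSemigroup.continuous_comp (hS : IsContractionSemigroup S) {X : Type*}
    [TopologicalSpace X] {a : X → ℝ} {f : X → H} (ha : Continuous a) (hf : Continuous f) :
    Continuous fun x => S (max (a x) 0) (f x) :=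
  hS.continuous_max_uncurry.comp (ha.prodMk hf)

variable [NormedSpace ℝ H]

/-- `z` is the mild solution of `z' = A z + f(t)`, `z(0) = z₀`, with `z` and `f` continuous. -/
structure IsForcedSolution (S : ℝ → H →L[𝕜] H) (f : ℝ → H) (z₀ : H) (z : ℝ → H) : Prop where
  continuous_force : Continuous f
  continuous : Continuous z
  eq : ∀ t : ℝ, 0 ≤ t → z t = S t z₀ + ∫ s in (0 : ℝ)..t, S (max (t - s) 0) (f s)

variable {f g z w : ℝ → H} {z₀ w₀ : H}

theorem IsForcedSolution.sub (hS : IsContractionSemigroup S) (hz : IsForcedSolution S f z₀ z)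
    (hw : IsForcedSolution S g w₀ w) :
    IsForcedSolution S (fun t => f t - g t) (z₀ - w₀) fun t => z t - w t where
  continuous_force := hz.continuous_force.sub hw.continuous_force
  continuous := hz.continuous.sub hw.continuous
  eq t ht := by
    rw [hz.eq t ht, hw.eq t ht]
    simp only [map_sub]
    rw [intervalIntegral.integral_sub]
    · abel
    · exact (hS.continuous_comp (by fun_prop) hz.continuous_force).intervalIntegrable _ _
    · exact (hS.continuous_comp (by fun_prop) hw.continuous_force).intervalIntegrable _ _

theorem IsForcedSolution.restart [CompleteSpace H] (hS : IsContractionSemigroup S)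
    (hz : IsForcedSolution S f z₀ z) {s t : ℝ} (hs : 0 ≤ s) (hst : s ≤ t) :
    z t = S (t - s) (z s) + ∫ τ in s..t, S (max (t - τ) 0) (f τ) := by
  have hi : ∀ t a b : ℝ, IntervalIntegrable (fun τ => S (max (t - τ) 0) (f τ)) volume a b :=
    fun t a b => (hS.continuous_comp (by fun_prop) hz.continuous_force).intervalIntegrable _ _
  have h1 : ∀ a : ℝ, 0 ≤ a → ∀ y, S (t - s) (S a y) = S (t - s + a) y := by
    intro a ha y
    rw [hS.map_add _ _ (by linarith) ha]; rfl
  rw [hz.eq t (hs.trans hst), hz.eq s hs, map_add, h1 s hs,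
    ← ContinuousLinearMap.intervalIntegral_comp_comm _ (hi s 0 s),
    ← intervalIntegral.integral_add_adjacent_intervals (hi t 0 s) (hi t s t), add_assoc]
  rw [show t - s + s = t by ring]
  congr 2
  apply intervalIntegral.integral_congr
  intro τ hτ
  rw [uIcc_of_le hs] at hτ
  simp only
  rw [h1 _ (le_max_right _ _), max_eq_left (by linarith [hτ.2]), max_eq_left (by linarith [hτ.2])]
  rw [show t - s + (s - τ) = t - τ by ring]

theorem IsForcedSolution.norm_sub_le [CompleteSpace H] (hS : IsContractionSemigroup S)
    (hz : IsForcedSolution S f z₀ z) {s t : ℝ} (hs : 0 ≤ s) (hst : s ≤ t) :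
    ‖z t - S (t - s) (z s)‖ ≤ ∫ τ in s..t, ‖f τ‖ := by
  rw [hz.restart hS hs hst, add_sub_cancel_left]
  apply intervalIntegral.norm_integral_le_of_norm_le hst
  · exact Eventually.of_forall fun τ _ => hS.norm_le _ (le_max_right _ _) _
  · exact hz.continuous_force.norm.intervalIntegrable _ _

theorem IsContractionSemigroup.tendsto_average (hS : IsContractionSemigroup S)
    [CompleteSpace H] (hf : Continuous f) (s : ℝ) :
    Tendsto (fun t : ℝ => (t - s)⁻¹ • ∫ τ in s..t, S (max (t - τ) 0) (f τ)) (𝓝[>] s)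
      (𝓝 (f s)) := by
  have hc : Continuous fun p : ℝ × ℝ => S (max (p.1 - p.2) 0) (f p.2) :=
    hS.continuous_comp (by fun_prop) (by fun_prop)
  rw [Metric.tendsto_nhdsWithin_nhds]
  intro ε hε
  obtain ⟨d, hd, h⟩ := Metric.continuous_iff.1 hc (s, s) (ε / 2) (by linarith)
  refine ⟨d, hd, fun t ht htd => ?_⟩
  have hst : 0 < t - s := by simpa using ht
  rw [Real.dist_eq, abs_of_pos hst] at htd
  have hi : IntervalIntegrable (fun τ => S (max (t - τ) 0) (f τ)) volume s t :=
    (hS.continuous_comp (by fun_prop) hf).intervalIntegrable _ _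
  have e : (t - s)⁻¹ • (∫ τ in s..t, S (max (t - τ) 0) (f τ)) - f s
      = (t - s)⁻¹ • ∫ τ in s..t, (S (max (t - τ) 0) (f τ) - f s) := by
    rw [intervalIntegral.integral_sub hi (by simp), intervalIntegral.integral_const, smul_sub,
      inv_smul_smul₀ hst.ne']
  have b : ‖∫ τ in s..t, (S (max (t - τ) 0) (f τ) - f s)‖ ≤ ε / 2 * |t - s| := by
    apply intervalIntegral.norm_integral_le_of_norm_le_const
    intro τ hτ
    rw [uIoc_of_le (by linarith)] at hτ
    have := h (t, τ) (by
      rw [Prod.dist_eq, Real.dist_eq, Real.dist_eq, abs_of_pos hst,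
        abs_of_pos (by linarith [hτ.1])]
      exact max_lt htd (by linarith [hτ.2]))
    simp only [sub_self, max_self, hS.map_zero, ContinuousLinearMap.id_apply, dist_eq_norm] at this
    exact this.le
  rw [dist_eq_norm, e, norm_smul, Real.norm_eq_abs, abs_inv, abs_of_pos hst]
  rw [abs_of_pos hst] at b
  calc (t - s)⁻¹ * _ ≤ (t - s)⁻¹ * (ε / 2 * (t - s)) := by gcongr
    _ = ε / 2 := by field_simp
    _ < ε := by linarith

/-- The upper right Dini derivative of `‖z‖²` is at most `2 Re ⟨z, f⟩`. -/
theorem IsForcedSolution.eventually_slope_lt [CompleteSpace H] (hS : IsContractionSemigroup S)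
    (hz : IsForcedSolution S f z₀ z) {s : ℝ} (hs : 0 ≤ s) {c : ℝ}
    (hc : 2 * RCLike.re (inner 𝕜 (z s) (f s)) < c) :
    ∀ᶠ t in 𝓝[>] s, slope (fun t => ‖z t‖ ^ 2) s t < c := by
  set e : ℝ → H := fun t => (t - s)⁻¹ • ∫ τ in s..t, S (max (t - τ) 0) (f τ) with he
  have he' : Tendsto e (𝓝[>] s) (𝓝 (f s)) := hS.tendsto_average hz.continuous_force s
  have hSz : Tendsto (fun t => S (max (t - s) 0) (z s)) (𝓝[>] s) (𝓝 (z s)) := by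
    have : Continuous fun t => S (max (t - s) 0) (z s) := hS.continuous_comp (by fun_prop) (by fun_prop)
    have := (this.tendsto s).mono_left (nhdsWithin_le_nhds (s := Ioi s))
    simpa [hS.map_zero] using this
  have hlim : Tendsto (fun t => 2 * RCLike.re (inner 𝕜 (S (max (t - s) 0) (z s)) (e t))
      + (t - s) * ‖e t‖ ^ 2) (𝓝[>] s) (𝓝 (2 * RCLike.re (inner 𝕜 (z s) (f s)) + 0 * ‖f s‖ ^ 2)) := by
    refine Tendsto.add ?_ (Tendsto.mul ?_ (he'.norm.pow 2))
    · exact ((RCLike.continuous_re.tendsto _).comp (hSz.inner he')).const_mul 2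
    · have : Continuous fun t : ℝ => t - s := by fun_prop
      simpa using (this.tendsto s).mono_left (nhdsWithin_le_nhds (s := Ioi s))
  rw [zero_mul, add_zero] at hlim
  filter_upwards [hlim.eventually_lt_const hc, self_mem_nhdsWithin] with t ht hst
  have hst : 0 < t - s := by simpa using hst
  refine lt_of_le_of_lt ?_ ht
  -- Expand the square of this sum: contractivity bounds the first term by `‖z s‖²`, and the rest
  -- divided by `t - s` tends to `2 Re ⟨z s, f s⟩` because `e → f s`.
  have hzt : z t = S (max (t - s) 0) (z s) + ((t - s : ℝ) : 𝕜) • e t := by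
    rw [hz.restart hS hs (by linarith), max_eq_left hst.le, he]
    simp only
    rw [← RCLike.real_smul_eq_coe_smul (K := 𝕜), smul_inv_smul₀ hst.ne']
  have hn := hS.norm_le (max (t - s) 0) (le_max_right _ _) (z s)
  rw [slope_def_field, div_le_iff₀ hst, hzt, norm_add_sq (𝕜 := 𝕜), inner_smul_right,
    RCLike.re_ofReal_mul, norm_smul, RCLike.norm_ofReal, abs_of_pos hst]
  have : ‖S (max (t - s) 0) (z s)‖ ^ 2 ≤ ‖z s‖ ^ 2 := by gcongr
  nlinarith

/-- A bound on the upper right Dini derivative suffices to compare `‖z‖²` with the primitive on the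
right. -/
theorem IsForcedSolution.energy_le [CompleteSpace H] (hS : IsContractionSemigroup S)
    (hz : IsForcedSolution S f z₀ z) {s t : ℝ} (hs : 0 ≤ s) (hst : s ≤ t) :
    ‖z t‖ ^ 2 ≤ ‖z s‖ ^ 2 + ∫ τ in s..t, 2 * RCLike.re (inner 𝕜 (z τ) (f τ)) := by
  have hzc := hz.continuous
  have hfc := hz.continuous_force
  have hc : Continuous fun τ => 2 * RCLike.re (inner 𝕜 (z τ) (f τ)) := by fun_prop
  have hd : ∀ x, HasDerivAt (fun t => ‖z s‖ ^ 2 + ∫ τ in s..t, 2 * RCLike.re (inner 𝕜 (z τ) (f τ)))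
      (2 * RCLike.re (inner 𝕜 (z x) (f x))) x := fun x =>
    (intervalIntegral.integral_hasDerivAt_right (hc.intervalIntegrable _ _)
      (hc.stronglyMeasurableAtFilter _ _) hc.continuousAt).const_add _
  refine image_le_of_liminf_slope_right_le_deriv_boundary (f := fun t => ‖z t‖ ^ 2)
    (a := s) (b := t) (by fun_prop) (by simp) (fun x _ => (hd x).continuousAt.continuousWithinAt)
    (fun x _ => (hd x).hasDerivWithinAt) ?_ (right_mem_Icc.2 hst)
  exact fun x hx r hr => (hz.eventually_slope_lt hS (hs.trans hx.1) hr).frequently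

/-- A quadratic one-sided growth condition and a zero initial value force the solution to
vanish. -/
theorem IsForcedSolution.eq_zero [CompleteSpace H] (hS : IsContractionSemigroup S)
    (hz : IsForcedSolution S f 0 z) {L : ℝ}
    (hL : ∀ t, 0 ≤ t → ‖f t‖ ≤ L * ‖z t‖) {t : ℝ} (ht : 0 ≤ t) : z t = 0 := by
  have hzc := hz.continuous
  have h0 : z 0 = 0 := by simp [hz.eq 0 le_rfl]
  -- By Cauchy–Schwarz the Dini derivative of `‖z‖²` is at most `2L ‖z‖²`.
  have := le_gronwallBound_of_liminf_deriv_right_le (f := fun t => ‖z t‖ ^ 2)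
    (f' := fun t => 2 * RCLike.re (inner 𝕜 (z t) (f t))) (δ := 0) (K := 2 * L) (ε := 0)
    (a := 0) (b := t) (by fun_prop)
    (fun x hx r hr => by
      simpa [slope_def_module] using (hz.eventually_slope_lt hS hx.1 hr).frequently) (by simp [h0])
    (fun x hx => by
      have h1 := (RCLike.re_le_norm _).trans (norm_inner_le_norm (𝕜 := 𝕜) (z x) (f x))
      have h2 := mul_le_mul_of_nonneg_left (hL x hx.1) (norm_nonneg (z x))
      nlinarith) t (right_mem_Icc.2 ht)
  simp only [gronwallBound_ε0, zero_mul] at this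
  have h3 : ‖z t‖ = 0 := by nlinarith [norm_nonneg (z t), sq_nonneg ‖z t‖]
  exact norm_eq_zero.1 h3

end ForcedEvolution

/-! ### The closed-loop field: dissipativity and local Lipschitz bound. -/

section Nonlinearity

variable {𝕜 H : Type*} [RCLike 𝕜] [NormedAddCommGroup H] [InnerProductSpace 𝕜 H]
  {S : ℝ → H →L[𝕜] H} {B : H →L[𝕜] H} {r : ℝ}

/-- No case split survives: at `y = 0` the factor `By` vanishes whatever value `0 ^ (-r)` has. -/
theorem closedLoop_feedback_eq (t : ℝ) (y : H) :
    closedLoop B (feedback B r) t y =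
      -(((‖y‖ ^ (-r) : ℝ) : 𝕜) • ((inner 𝕜 (B y) y : 𝕜) • B y)) := by
  unfold closedLoop feedback
  split_ifs with h
  · simp [h]
  · rw [neg_smul, smul_smul, Real.rpow_neg (norm_nonneg _), RCLike.ofReal_inv, div_eq_inv_mul]

theorem closedLoop_feedback_zero (t : ℝ) : closedLoop B (feedback B r) t 0 = 0 := by
  simp [closedLoop_feedback_eq]

theorem re_inner_closedLoop_feedback (t : ℝ) (y : H) :
    RCLike.re (inner 𝕜 y (closedLoop B (feedback B r) t y)) =
      -(‖y‖ ^ (-r) * ‖(inner 𝕜 (B y) y : 𝕜)‖ ^ 2) := by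
  rw [closedLoop_feedback_eq, inner_neg_right, inner_smul_right, inner_smul_right,
    ← inner_conj_symm y (B y), RCLike.mul_conj, map_neg, RCLike.re_ofReal_mul]
  norm_cast

theorem re_inner_closedLoop_feedback_nonpos (t : ℝ) (y : H) :
    RCLike.re (inner 𝕜 y (closedLoop B (feedback B r) t y)) ≤ 0 := by
  rw [re_inner_closedLoop_feedback, neg_nonpos]
  positivity

theorem norm_closedLoop_feedback (t : ℝ) (y : H) :
    ‖closedLoop B (feedback B r) t y‖ = ‖y‖ ^ (-r) * (‖(inner 𝕜 (B y) y : 𝕜)‖ * ‖B y‖) := by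
  rw [closedLoop_feedback_eq, norm_neg, norm_smul, norm_smul, RCLike.norm_ofReal,
    abs_of_nonneg (by positivity)]

/-- Mean value inequality with `x^(σ-1) = x^(σ+2) / x³`, whose numerator is increasing. The weight
`a³` is supplied later by the cubic map `x ↦ ⟨Bx, x⟩ Bx`, which tames the singular power. -/
theorem abs_rpow_sub_rpow_mul_pow_le {a b : ℝ} (ha : 0 < a) (hab : a ≤ b) {σ : ℝ} (hσ : -2 < σ) :
    |b ^ σ - a ^ σ| * a ^ 3 ≤ |σ| * b ^ (σ + 2) * (b - a) := by
  have hb : ∀ x ∈ Icc a b, ‖σ * x ^ (σ - 1)‖ ≤ |σ| * b ^ (σ + 2) / a ^ 3 := by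
    intro x hx
    have hx0 : 0 < x := ha.trans_le hx.1
    rw [norm_mul, Real.norm_eq_abs, Real.norm_eq_abs, abs_of_pos (Real.rpow_pos_of_pos hx0 _),
      mul_div_assoc, show σ - 1 = (σ + 2) - (3 : ℕ) by push_cast; ring, Real.rpow_sub hx0,
      Real.rpow_natCast]
    have := hx.1
    have := Real.rpow_pos_of_pos (ha.trans_le hab) (σ + 2)
    have : x ^ (σ + 2) ≤ b ^ (σ + 2) := Real.rpow_le_rpow hx0.le hx.2 (by linarith)
    gcongr
  have := Convex.norm_image_sub_le_of_norm_hasDerivWithin_le (f := fun x : ℝ => x ^ σ)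
    (fun x hx => (Real.hasDerivAt_rpow_const (p := σ)
      (Or.inl (ha.trans_le hx.1).ne')).hasDerivWithinAt) hb (convex_Icc a b)
    (left_mem_Icc.2 hab) (right_mem_Icc.2 hab)
  rw [Real.norm_eq_abs, Real.norm_eq_abs, abs_of_nonneg (sub_nonneg.2 hab)] at this
  calc |b ^ σ - a ^ σ| * a ^ 3 ≤ (|σ| * b ^ (σ + 2) / a ^ 3 * (b - a)) * a ^ 3 := by gcongr
    _ = _ := by field_simp

theorem norm_inner_smul_le (B : H →L[𝕜] H) (x : H) :
    ‖(inner 𝕜 (B x) x : 𝕜) • B x‖ ≤ ‖B‖ ^ 2 * ‖x‖ ^ 3 := by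
  rw [norm_smul]
  have h1 := B.le_opNorm x
  calc _ ≤ (‖B x‖ * ‖x‖) * ‖B x‖ := by gcongr; exact norm_inner_le_norm _ _
    _ ≤ ((‖B‖ * ‖x‖) * ‖x‖) * (‖B‖ * ‖x‖) := by gcongr
    _ = _ := by ring

theorem norm_inner_smul_sub_le (B : H →L[𝕜] H) {x y : H} (hxy : ‖x‖ ≤ ‖y‖) :
    ‖(inner 𝕜 (B y) y : 𝕜) • B y - (inner 𝕜 (B x) x : 𝕜) • B x‖ ≤
      3 * ‖B‖ ^ 2 * ‖y‖ ^ 2 * ‖y - x‖ := by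
  have e : (inner 𝕜 (B y) y : 𝕜) • B y - (inner 𝕜 (B x) x : 𝕜) • B x =
      (inner 𝕜 (B y) y : 𝕜) • B (y - x) + (inner 𝕜 (B (y - x)) y : 𝕜) • B x
        + (inner 𝕜 (B x) (y - x) : 𝕜) • B x := by
    rw [map_sub, inner_sub_left, inner_sub_right]
    module
  have h1 : ∀ u v w : H, ‖(inner 𝕜 (B u) v : 𝕜) • B w‖ ≤ ‖B‖ ^ 2 * (‖u‖ * ‖v‖ * ‖w‖) := by
    intro u v w
    rw [norm_smul]
    have h1 := B.le_opNorm u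
    have h2 := B.le_opNorm w
    calc _ ≤ (‖B u‖ * ‖v‖) * ‖B w‖ := by gcongr; exact norm_inner_le_norm _ _
      _ ≤ ((‖B‖ * ‖u‖) * ‖v‖) * (‖B‖ * ‖w‖) := by gcongr
      _ = _ := by ring
  rw [e]
  calc _ ≤ ‖B‖ ^ 2 * (‖y‖ * ‖y‖ * ‖y - x‖) + ‖B‖ ^ 2 * (‖y - x‖ * ‖y‖ * ‖x‖)
        + ‖B‖ ^ 2 * (‖x‖ * ‖y - x‖ * ‖x‖) := 
        norm_add₃_le.trans (add_le_add (add_le_add (h1 _ _ _) (h1 _ _ _)) (h1 _ _ _))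
    _ ≤ ‖B‖ ^ 2 * (‖y‖ * ‖y‖ * ‖y - x‖) + ‖B‖ ^ 2 * (‖y - x‖ * ‖y‖ * ‖y‖)
        + ‖B‖ ^ 2 * (‖y‖ * ‖y - x‖ * ‖y‖) := by gcongr
    _ = _ := by ring

/-- With `‖x‖ ≤ ‖y‖`, vary the cubic factor at weight `‖y‖^(-r)` (contributing `3`), then the weight
at the smaller point `x` (contributing `|r|`). -/
theorem norm_closedLoop_feedback_sub_le (hr : r < 2) {R : ℝ} (t : ℝ) {x y : H}
    (hx : ‖x‖ ≤ R) (hy : ‖y‖ ≤ R) :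
    ‖closedLoop B (feedback B r) t y - closedLoop B (feedback B r) t x‖ ≤
      (3 + |r|) * ‖B‖ ^ 2 * R ^ (2 - r) * ‖y - x‖ := by
  wlog hxy : ‖x‖ ≤ ‖y‖ generalizing x y
  · rw [norm_sub_rev, norm_sub_rev y]
    exact this hy hx (le_of_not_ge hxy)
  rcases eq_or_ne y 0 with rfl | hy0
  · obtain rfl : x = 0 := by simpa using hxy
    simp
  have hyp : 0 < ‖y‖ := norm_pos_iff.2 hy0
  have hyR : ‖y‖ ^ (2 - r) ≤ R ^ (2 - r) := Real.rpow_le_rpow hyp.le hy (by linarith)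
  have hpow : ‖y‖ ^ (-r) * ‖y‖ ^ 2 = ‖y‖ ^ (2 - r) := by
    rw [← Real.rpow_natCast, ← Real.rpow_add hyp]; congr 1; push_cast; ring
  suffices h : ‖closedLoop B (feedback B r) t y - closedLoop B (feedback B r) t x‖ ≤
      (3 + |r|) * ‖B‖ ^ 2 * ‖y‖ ^ (2 - r) * ‖y - x‖ from h.trans (by gcongr)
  have hsub := norm_inner_smul_sub_le B hxy
  have e : closedLoop B (feedback B r) t y - closedLoop B (feedback B r) t x =
      -(((‖y‖ ^ (-r) : ℝ) : 𝕜) • ((inner 𝕜 (B y) y : 𝕜) • B y - (inner 𝕜 (B x) x : 𝕜) • B x)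
        + ((‖y‖ ^ (-r) - ‖x‖ ^ (-r) : ℝ) : 𝕜) • ((inner 𝕜 (B x) x : 𝕜) • B x)) := by
    rw [closedLoop_feedback_eq, closedLoop_feedback_eq]
    push_cast
    module
  have h2 : |‖y‖ ^ (-r) - ‖x‖ ^ (-r)| * (‖B‖ ^ 2 * ‖x‖ ^ 3) ≤
      |r| * ‖B‖ ^ 2 * ‖y‖ ^ (2 - r) * ‖y - x‖ := by
    rcases eq_or_ne x 0 with rfl | hx0
    · simp; positivity
    have := abs_rpow_sub_rpow_mul_pow_le (norm_pos_iff.2 hx0) hxy (σ := -r) (by linarith)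
    rw [abs_neg, show -r + 2 = 2 - r by ring] at this
    calc _ = ‖B‖ ^ 2 * (|‖y‖ ^ (-r) - ‖x‖ ^ (-r)| * ‖x‖ ^ 3) := by ring
      _ ≤ ‖B‖ ^ 2 * (|r| * ‖y‖ ^ (2 - r) * (‖y‖ - ‖x‖)) := by gcongr
      _ ≤ ‖B‖ ^ 2 * (|r| * ‖y‖ ^ (2 - r) * ‖y - x‖) := by gcongr; exact norm_sub_norm_le _ _
      _ = _ := by ring
  rw [e, norm_neg]
  refine (norm_add_le _ _).trans ?_
  rw [norm_smul, norm_smul _ ((inner 𝕜 (B x) x : 𝕜) • B x), RCLike.norm_ofReal, RCLike.norm_ofReal,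
    abs_of_nonneg (by positivity : 0 ≤ ‖y‖ ^ (-r))]
  calc _ ≤ ‖y‖ ^ (-r) * (3 * ‖B‖ ^ 2 * ‖y‖ ^ 2 * ‖y - x‖)
        + |‖y‖ ^ (-r) - ‖x‖ ^ (-r)| * (‖B‖ ^ 2 * ‖x‖ ^ 3) := by
        gcongr; exact norm_inner_smul_le B x
    _ ≤ 3 * ‖B‖ ^ 2 * (‖y‖ ^ (-r) * ‖y‖ ^ 2) * ‖y - x‖
        + |r| * ‖B‖ ^ 2 * ‖y‖ ^ (2 - r) * ‖y - x‖ := by linarith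
    _ = _ := by rw [hpow]; ring

theorem continuous_closedLoop_feedback (hr : r < 2) (t : ℝ) :
    Continuous (closedLoop B (feedback B r) t) := by
  rw [continuous_iff_continuousAt]
  intro x
  set K : ℝ := (3 + |r|) * ‖B‖ ^ 2 * (‖x‖ + 1) ^ (2 - r)
  rw [ContinuousAt, tendsto_iff_norm_sub_tendsto_zero]
  have hK : Tendsto (fun y => K * ‖y - x‖) (𝓝 x) (𝓝 0) := by
    have : Continuous fun y => K * ‖y - x‖ := by fun_prop
    simpa using this.tendsto x
  refine squeeze_zero' (Eventually.of_forall fun _ => norm_nonneg _) ?_ hK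
  filter_upwards [continuous_norm.continuousAt.eventually_lt_const (lt_add_one ‖x‖)] with y hy
  exact norm_closedLoop_feedback_sub_le hr t (by linarith) hy.le

end Nonlinearity

/-! ### Radial retraction onto a ball. -/

section Truncation

variable {H : Type*} [NormedAddCommGroup H] [NormedSpace ℝ H]

/-- The radial retraction onto the closed ball of radius `R`. -/
def radialRetraction (R : ℝ) (y : H) : H := (R / max R ‖y‖) • y

theorem norm_radialRetraction_le {R : ℝ} (hR : 0 < R) (y : H) : ‖radialRetraction R y‖ ≤ R := by
  have hm : 0 < max R ‖y‖ := lt_max_of_lt_left hR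
  rw [radialRetraction, norm_smul, Real.norm_eq_abs, abs_of_nonneg (by positivity), div_mul_eq_mul_div,
    div_le_iff₀ hm]
  gcongr
  exact le_max_right _ _

theorem radialRetraction_of_norm_le {R : ℝ} (hR : 0 < R) {y : H} (hy : ‖y‖ ≤ R) :
    radialRetraction R y = y := by
  rw [radialRetraction, max_eq_left hy, div_self hR.ne', one_smul]

theorem norm_radialRetraction_sub_le {R : ℝ} (hR : 0 < R) (x y : H) :
    ‖radialRetraction R x - radialRetraction R y‖ ≤ 2 * ‖x - y‖ := by
  have hm : 0 < max R ‖x‖ := lt_max_of_lt_left hR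
  have hn : 0 < max R ‖y‖ := lt_max_of_lt_left hR
  have e : radialRetraction R x - radialRetraction R y =
      (R / max R ‖x‖) • (x - y) + (R / max R ‖x‖ - R / max R ‖y‖) • y := by
    simp only [radialRetraction]; module
  have h1 : R / max R ‖x‖ ≤ 1 := (div_le_one hm).2 (le_max_left _ _)
  have h2 : |R / max R ‖x‖ - R / max R ‖y‖| * ‖y‖ ≤ ‖x - y‖ := by
    have e2 : R / max R ‖x‖ - R / max R ‖y‖ =
        (R / max R ‖x‖) * (max R ‖y‖ - max R ‖x‖) / max R ‖y‖ := by field_simp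
    rw [e2, abs_div, abs_mul, abs_of_pos hn, abs_of_pos (div_pos hR hm), div_mul_eq_mul_div,
      div_le_iff₀ hn]
    have h3 : |max R ‖y‖ - max R ‖x‖| ≤ ‖x - y‖ := by
      rw [max_comm R, max_comm R, norm_sub_rev]
      exact (abs_max_sub_max_le_abs _ _ _).trans (abs_norm_sub_norm_le _ _)
    calc _ ≤ 1 * ‖x - y‖ * max R ‖y‖ := by gcongr; exact le_max_right _ _
      _ = _ := by ring
  rw [e]
  refine (norm_add_le _ _).trans ?_
  rw [norm_smul, norm_smul, Real.norm_eq_abs, Real.norm_eq_abs, abs_of_pos (div_pos hR hm)]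
  nlinarith [norm_nonneg (x - y)]

end Truncation

open scoped BoundedContinuousFunction

/-! ### Globally Lipschitz equations, by contraction in a weighted norm. -/

section Existence

variable {𝕜 H : Type*} [RCLike 𝕜] [NormedAddCommGroup H] [InnerProductSpace 𝕜 H]
  {S : ℝ → H →L[𝕜] H} [NormedSpace ℝ H]

/-- The exponential weight gains a factor `1 / l` uniformly in `t`, so one fixed point covers all
times. -/
theorem IsContractionSemigroup.norm_weighted_integral_le (hS : IsContractionSemigroup S)
    {f : ℝ → H} {C l t : ℝ} (hl : 0 < l) (hC : 0 ≤ C) (ht : 0 ≤ t)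
    (hf : ∀ s, ‖f s‖ ≤ C * Real.exp (l * s)) :
    ‖Real.exp (-(l * t)) • ∫ s in (0 : ℝ)..t, S (max (t - s) 0) (f s)‖ ≤ C / l := by
  have h1 : ‖∫ s in (0 : ℝ)..t, S (max (t - s) 0) (f s)‖ ≤
      ∫ s in (0 : ℝ)..t, C * Real.exp (l * s) := by
    apply intervalIntegral.norm_integral_le_of_norm_le ht
    · exact Eventually.of_forall fun s _ => (hS.norm_le _ (le_max_right _ _) _).trans (hf s)
    · exact Continuous.intervalIntegrable (by fun_prop) _ _
  have h2 : ∫ s in (0 : ℝ)..t, C * Real.exp (l * s) = C / l * (Real.exp (l * t) - 1) := by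
    rw [intervalIntegral.integral_const_mul, intervalIntegral.integral_comp_mul_left _ hl.ne',
      integral_exp]
    simp; ring
  rw [norm_smul, Real.norm_eq_abs, abs_of_pos (Real.exp_pos _)]
  rw [h2] at h1
  calc _ ≤ Real.exp (-(l * t)) * (C / l * (Real.exp (l * t) - 1)) := by gcongr
    _ = C / l * (1 - Real.exp (-(l * t))) := by
      rw [Real.exp_neg]; field_simp
    _ ≤ C / l * 1 := by gcongr; linarith [Real.exp_pos (-(l * t))]
    _ = _ := mul_one _

/-- The Duhamel map of `z' = A z + G(z)`, conjugated by the weight `exp (l t)`. -/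
def weightedDuhamel (S : ℝ → H →L[𝕜] H) (G : H → H) (z₀ : H) (l : ℝ) (u : ℝ → H) (t : ℝ) : H :=
  Real.exp (-(l * max t 0)) • (S (max t 0) z₀ + ∫ s in (0 : ℝ)..max t 0,
    S (max (max t 0 - s) 0) (G (Real.exp (l * s) • u s)))

theorem IsContractionSemigroup.continuous_weightedDuhamel (hS : IsContractionSemigroup S)
    {G : H → H} (hG : Continuous G) (z₀ : H) (l : ℝ) {u : ℝ → H} (hu : Continuous u) :
    Continuous (weightedDuhamel S G z₀ l u) := by
  unfold weightedDuhamel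
  refine Continuous.smul (by fun_prop) ((hS.continuous_max z₀).add ?_)
  refine intervalIntegral.continuous_parametric_intervalIntegral_of_continuous ?_ (by fun_prop)
  exact hS.continuous_comp (a := fun p : ℝ × ℝ => max p.1 0 - p.2)
    (f := fun p : ℝ × ℝ => G (Real.exp (l * p.2) • u p.2)) (by fun_prop) (by fun_prop)

theorem IsContractionSemigroup.exists_isForcedSolution [CompleteSpace H]
    (hS : IsContractionSemigroup S) {G : H → H} {L : ℝ} (hL : 0 < L)
    (hG : ∀ x y, ‖G x - G y‖ ≤ L * ‖x - y‖) (hG0 : G 0 = 0) (z₀ : H) :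
    ∃ z, IsForcedSolution S (fun t => G (z t)) z₀ z := by
  have hGc : Continuous G := by
    refine (LipschitzWith.of_dist_le_mul (K := L.toNNReal) fun x y => ?_).continuous
    rw [dist_eq_norm, dist_eq_norm, Real.coe_toNNReal _ hL.le]
    exact hG x y
  -- This makes the contraction constant `L / l` equal to `1 / 2`.
  set l := 2 * L with hl
  have hl0 : 0 < l := by positivity
  have hexp : ∀ s (x : H), ‖Real.exp (l * s) • x‖ = Real.exp (l * s) * ‖x‖ := fun s x => by
    rw [norm_smul, Real.norm_eq_abs, abs_of_pos (Real.exp_pos _)]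
  have hbound : ∀ (u : ℝ →ᵇ H) t, ‖weightedDuhamel S G z₀ l u t‖ ≤ ‖z₀‖ + L * ‖u‖ / l := by
    intro u t
    rw [weightedDuhamel, smul_add]
    refine (norm_add_le _ _).trans (add_le_add ?_ ?_)
    · rw [norm_smul, Real.norm_eq_abs, abs_of_pos (Real.exp_pos _)]
      have h1 : Real.exp (-(l * max t 0)) ≤ 1 := by
        rw [Real.exp_le_one_iff, neg_nonpos]
        exact mul_nonneg hl0.le (le_max_right _ _)
      calc _ ≤ 1 * ‖z₀‖ := by gcongr; exact hS.norm_le _ (le_max_right _ _) _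
        _ = _ := one_mul _
    · refine hS.norm_weighted_integral_le hl0 (by positivity) (le_max_right _ _) fun s => ?_
      have := hG (Real.exp (l * s) • u s) 0
      rw [hG0, sub_zero, sub_zero, hexp] at this
      have h2 := u.norm_coe_le_norm s
      calc _ ≤ _ := this
        _ ≤ L * (Real.exp (l * s) * ‖u‖) := by gcongr
        _ = _ := by ring
  let Φ : (ℝ →ᵇ H) → (ℝ →ᵇ H) := fun u => BoundedContinuousFunction.ofNormedAddCommGroup
    (weightedDuhamel S G z₀ l u) (hS.continuous_weightedDuhamel hGc z₀ l u.continuous) _ (hbound u)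
  have hΦ : ContractingWith (1 / 2) Φ := by
    refine ⟨by norm_num [← NNReal.coe_lt_coe], LipschitzWith.of_dist_le_mul fun u w => ?_⟩
    rw [BoundedContinuousFunction.dist_le (by positivity)]
    intro t
    have hi : ∀ u : ℝ →ᵇ H, IntervalIntegrable (fun s =>
        S (max (max t 0 - s) 0) (G (Real.exp (l * s) • u s))) volume 0 (max t 0) := fun u =>
      (hS.continuous_comp (by fun_prop) (by fun_prop)).intervalIntegrable _ _
    have e : Φ u t - Φ w t = Real.exp (-(l * max t 0)) • ∫ s in (0 : ℝ)..max t 0,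
        S (max (max t 0 - s) 0) (G (Real.exp (l * s) • u s) - G (Real.exp (l * s) • w s)) := by
      simp only [map_sub]
      rw [intervalIntegral.integral_sub (hi u) (hi w)]
      simp only [Φ, BoundedContinuousFunction.coe_ofNormedAddCommGroup, weightedDuhamel]
      module
    rw [dist_eq_norm, e]
    refine (hS.norm_weighted_integral_le (C := L * dist u w) hl0 (by positivity) (le_max_right _ _)
      fun s => ?_).trans (le_of_eq ?_)
    · refine (hG _ _).trans ?_
      rw [← smul_sub, hexp, ← dist_eq_norm]
      have h2 := BoundedContinuousFunction.dist_coe_le_dist (f := u) (g := w) s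
      calc _ ≤ L * (Real.exp (l * s) * dist u w) := by gcongr
        _ = _ := by ring
    · rw [hl]; push_cast; field_simp
  set u := ContractingWith.fixedPoint Φ hΦ
  have hu : Φ u = u := ContractingWith.fixedPoint_isFixedPt hΦ
  refine ⟨fun t => Real.exp (l * t) • u t, by fun_prop, by fun_prop, fun t ht => ?_⟩
  have h1 : u t = weightedDuhamel S G z₀ l u t := by
    conv_lhs => rw [← hu]
    rfl
  simp only
  rw [h1, weightedDuhamel, max_eq_left ht, smul_smul, ← Real.exp_add, add_neg_cancel, Real.exp_zero,
    one_smul]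

end Existence

/-! ### Well-posedness of the closed loop. -/

section ClosedLoop

variable {𝕜 H : Type*} [RCLike 𝕜] [NormedAddCommGroup H] [InnerProductSpace 𝕜 H]
  {S : ℝ → H →L[𝕜] H} {B : H →L[𝕜] H} {r : ℝ} [NormedSpace ℝ H] {z₀ : H} {z w : ℝ → H}

theorem IsMildSolution.isForcedSolution {F : H → H} (hF : Continuous F)
    (hz : IsMildSolution S (fun _ => F) z₀ z) :
    IsForcedSolution S (fun t => F (z (max t 0))) z₀ fun t => z (max t 0) := by
  have hzc : Continuous fun t => z (max t 0) :=
    hz.continuousOn.comp_continuous (by fun_prop) fun t => mem_Ici.2 (le_max_right _ _)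
  refine ⟨hF.comp hzc, hzc, fun t ht => ?_⟩
  rw [max_eq_left ht, hz.eq t ht]
  congr 1
  apply intervalIntegral.integral_congr
  intro s hs
  rw [uIcc_of_le ht] at hs
  simp only
  rw [max_eq_left hs.1, max_eq_left (by linarith [hs.2])]

theorem IsForcedSolution.isMildSolution (hS : IsContractionSemigroup S) {f : ℝ → H}
    {F : ℝ → H → H} (hf : ∀ t, 0 ≤ t → f t = F t (z t)) (hz : IsForcedSolution S f z₀ z) :
    IsMildSolution S F z₀ z := by
  have h : ∀ t, 0 ≤ t → EqOn (fun s => S (max (t - s) 0) (f s)) (fun s => S (t - s) (F s (z s)))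
      (uIcc 0 t) := by
    intro t ht s hs
    rw [uIcc_of_le ht] at hs
    simp only
    rw [hf s hs.1, max_eq_left (by linarith [hs.2])]
  refine ⟨hz.continuous.continuousOn, fun t ht => ?_, fun t ht => ?_⟩
  · refine IntervalIntegrable.congr ((h t ht).mono uIoc_subset_uIcc) ?_
    exact (hS.continuous_comp (by fun_prop) hz.continuous_force).intervalIntegrable _ _
  · rw [hz.eq t ht, intervalIntegral.integral_congr (h t ht)]

variable [CompleteSpace H]

theorem IsForcedSolution.norm_le_norm {f : ℝ → H} (hS : IsContractionSemigroup S)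
    (hz : IsForcedSolution S f z₀ z) (hf : ∀ t, RCLike.re (inner 𝕜 (z t) (f t)) ≤ 0) {s t : ℝ}
    (hs : 0 ≤ s) (hst : s ≤ t) : ‖z t‖ ≤ ‖z s‖ := by
  have h := hz.energy_le hS hs hst
  have h0 : ∫ τ in s..t, 2 * RCLike.re (inner 𝕜 (z τ) (f τ)) ≤ 0 := by
    have hc := hz.continuous
    have hfc := hz.continuous_force
    have := intervalIntegral.integral_mono_on (μ := volume)
      (f := fun τ => 2 * RCLike.re (inner 𝕜 (z τ) (f τ))) (g := fun _ => 0) hst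
      (Continuous.intervalIntegrable (by fun_prop) _ _) (by simp)
      fun τ _ => by linarith [hf τ]
    simpa using this
  exact le_of_sq_le_sq (by linarith) (norm_nonneg _)

theorem IsForcedSolution.norm_le_initial {f : ℝ → H} (hS : IsContractionSemigroup S)
    (hz : IsForcedSolution S f z₀ z) (hf : ∀ t, RCLike.re (inner 𝕜 (z t) (f t)) ≤ 0) {t : ℝ}
    (ht : 0 ≤ t) : ‖z t‖ ≤ ‖z₀‖ := by
  have h0 : z 0 = z₀ := by simp [hz.eq 0 le_rfl, hS.map_zero]
  exact h0 ▸ hz.norm_le_norm hS hf le_rfl ht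

theorem exists_isMildSolution_closedLoop_feedback (hS : IsContractionSemigroup S) (hr : r < 2)
    (z₀ : H) : ∃ z, IsMildSolution S (closedLoop B (feedback B r)) z₀ z := by
  set R := ‖z₀‖ + 1 with hR
  have hR0 : 0 < R := by positivity
  set G : H → H := fun y => closedLoop B (feedback B r) 0 (radialRetraction R y) with hG
  set K := (3 + |r|) * ‖B‖ ^ 2 * R ^ (2 - r) with hK
  have hK0 : 0 ≤ K := by positivity
  obtain ⟨z, hz⟩ := hS.exists_isForcedSolution (G := G) (L := K * 2 + 1) (by positivity)
    (fun x y => by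
      calc _ ≤ K * ‖radialRetraction R x - radialRetraction R y‖ :=
          norm_closedLoop_feedback_sub_le hr 0 (norm_radialRetraction_le hR0 y)
            (norm_radialRetraction_le hR0 x)
        _ ≤ K * (2 * ‖x - y‖) := by gcongr; exact norm_radialRetraction_sub_le hR0 x y
        _ ≤ _ := by nlinarith [norm_nonneg (x - y)])
    (by simp [hG, radialRetraction, closedLoop_feedback_zero]) z₀
  -- The retraction of `y` is a positive multiple of `y`, so truncation preserves dissipativity.
  have hdiss : ∀ y, RCLike.re (inner 𝕜 y (G y)) ≤ 0 := by
    intro y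
    have h := re_inner_closedLoop_feedback_nonpos (B := B) (r := r) (𝕜 := 𝕜) 0 (radialRetraction R y)
    have hc : 0 < R / max R ‖y‖ := div_pos hR0 (lt_max_of_lt_left hR0)
    nth_rewrite 1 [radialRetraction] at h
    rw [RCLike.real_smul_eq_coe_smul (K := 𝕜), inner_smul_left, RCLike.conj_ofReal,
      RCLike.re_ofReal_mul] at h
    exact nonpos_of_mul_nonpos_right h hc
  refine ⟨z, hz.isMildSolution hS fun t ht => ?_⟩
  have := hz.norm_le_initial hS (fun t => hdiss (z t)) ht
  simp only [hG]
  rw [radialRetraction_of_norm_le hR0 (by linarith)]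
  rfl

/-- Both solutions stay in the ball of radius `‖z₀‖`, where the field is Lipschitz; their difference
starts at `0`. -/
theorem IsMildSolution.eqOn_of_closedLoop_feedback (hS : IsContractionSemigroup S) (hr : r < 2)
    (hz : IsMildSolution S (closedLoop B (feedback B r)) z₀ z)
    (hw : IsMildSolution S (closedLoop B (feedback B r)) z₀ w) : EqOn z w (Ici 0) := by
  intro t ht
  have hF := continuous_closedLoop_feedback (B := B) (𝕜 := 𝕜) hr 0
  have hz' := IsMildSolution.isForcedSolution hF hz
  have hw' := IsMildSolution.isForcedSolution hF hw
  have hd := hz'.sub hS hw'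
  rw [sub_self] at hd
  have := hd.eq_zero hS (fun s hs => norm_closedLoop_feedback_sub_le hr 0
    (hw'.norm_le_initial hS (fun t => re_inner_closedLoop_feedback_nonpos 0 _) hs)
    (hz'.norm_le_initial hS (fun t => re_inner_closedLoop_feedback_nonpos 0 _) hs)) ht
  rw [max_eq_left ht] at this
  exact sub_eq_zero.1 this

end ClosedLoop

/-! ### From a discrete nonlinear inequality to a polynomial rate. -/

section RealDecay

/-- Each step raises `E^(-a)` by at least `c a`, by the Bernoulli-type bound `(1 - x)^(-a) ≥ 1 + a
x` at `x = c E^a`. The case `E n = 0` stands apart because `0 ^ (-a)` is `0` here, not infinity. -/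
theorem mul_le_rpow_neg_of_le_sub_mul_rpow {E : ℕ → ℝ} {a c : ℝ} (ha : 0 < a) (hc : 0 < c)
    (hE : ∀ n, 0 ≤ E n) (h : ∀ n, E (n + 1) ≤ E n - c * E n ^ (1 + a)) (n : ℕ) :
    E n = 0 ∨ n * (c * a) ≤ E n ^ (-a) := by
  induction n with
  | zero => right; simpa using Real.rpow_nonneg (hE 0) _
  | succ n ih =>
    have hn := h n
    rcases (hE n).eq_or_lt' with h0 | h0
    · left
      rw [h0, Real.zero_rpow (by positivity)] at hn
      linarith [hE (n + 1)]
    rcases (hE (n + 1)).eq_or_lt' with h1 | h1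
    · exact Or.inl h1
    right
    have ih := ih.resolve_left h0.ne'
    set x := c * E n ^ a with hx
    have hx0 : 0 < x := by positivity
    rw [Real.rpow_add h0, Real.rpow_one] at hn
    have hn' : E (n + 1) ≤ E n * (1 - x) := by rw [hx]; linarith
    have hx1 : 0 < 1 - x := pos_of_mul_pos_right (h1.trans_le hn') h0.le
    have hlog : 1 + a * x ≤ (1 - x) ^ (-a) := by
      rw [Real.rpow_def_of_pos hx1]
      have := Real.log_le_sub_one_of_pos hx1
      have h2 := Real.add_one_le_exp (Real.log (1 - x) * -a)
      nlinarith
    calc ((n + 1 : ℕ) : ℝ) * (c * a) = n * (c * a) + c * a := by push_cast; ring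
      _ ≤ E n ^ (-a) + c * a := by gcongr
      _ = E n ^ (-a) * (1 + a * x) := by
        rw [hx, Real.rpow_neg h0.le]
        have := (Real.rpow_pos_of_pos h0 a).ne'
        field_simp
      _ ≤ E n ^ (-a) * (1 - x) ^ (-a) := by gcongr
      _ = (E n * (1 - x)) ^ (-a) := (Real.mul_rpow h0.le hx1.le).symm
      _ ≤ E (n + 1) ^ (-a) := Real.rpow_le_rpow_of_nonpos h1 hn' (by linarith)

theorem isBigO_rpow_of_sq_le_sub_mul_rpow {x : ℝ → ℝ} {T c p : ℝ} (hT : 0 < T) (hc : 0 < c)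
    (hp : 0 < p) (hx0 : ∀ t, 0 ≤ x t) (hanti : ∀ s t, 0 ≤ s → s ≤ t → x t ≤ x s)
    (h : ∀ s, 0 ≤ s → x (s + T) ^ 2 ≤ x s ^ 2 - c * (x s ^ 2) ^ (1 + p / 2)) :
    x =O[atTop] fun t => t ^ (-(1 / p)) := by
  -- For `t ≥ 2T` the integer part of `t / T` is at least `t / (2T)`; hence the `2` in the
  -- denominator.
  set k := c * (p / 2) / (2 * T) with hk
  have hk0 : 0 < k := by positivity
  have hseq := mul_le_rpow_neg_of_le_sub_mul_rpow (E := fun n : ℕ => x (n * T) ^ 2)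
    (half_pos hp) hc (fun n => sq_nonneg _) (fun n => by
      have := h (n * T) (by positivity)
      convert! this using 3
      push_cast; ring)
  refine IsBigO.of_bound (k ^ (-(1 / p))) ?_
  filter_upwards [eventually_ge_atTop (2 * T)] with t ht
  have ht0 : 0 < t := by linarith
  set n := ⌊t / T⌋₊
  have hn1 : n * T ≤ t := by
    rw [← le_div_iff₀ hT]; exact Nat.floor_le (by positivity)
  have hn2 : t / (2 * T) ≤ n := by
    have h1 := Nat.lt_floor_add_one (t / T)
    have h2 : 2 ≤ t / T := by rwa [le_div_iff₀ hT]
    have h3 : t / (2 * T) = t / T / 2 := by field_simp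
    rw [h3]
    linarith
  have hxt := hanti (n * T) t (by positivity) hn1
  rw [Real.norm_of_nonneg (hx0 t), Real.norm_of_nonneg (by positivity), ← Real.mul_rpow hk0.le ht0.le]
  refine hxt.trans ?_
  rcases (hx0 (n * T)).eq_or_lt' with h0 | h0
  · rw [h0]; positivity
  have hne : x (n * T) ^ 2 ≠ 0 := by positivity
  have h1 := (hseq n).resolve_left hne
  have h2 : k * t ≤ x (n * T) ^ (-p) := by
    rw [← Real.rpow_natCast, ← Real.rpow_mul h0.le] at h1
    calc k * t = t / (2 * T) * (c * (p / 2)) := by rw [hk]; ring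
      _ ≤ n * (c * (p / 2)) := by gcongr
      _ ≤ _ := h1
      _ = _ := by congr 1; push_cast; ring
  calc x (n * T) = (x (n * T) ^ (-p)) ^ (-(1 / p)) := by
        rw [← Real.rpow_mul h0.le, neg_mul_neg, mul_one_div_cancel hp.ne', Real.rpow_one]
    _ ≤ (k * t) ^ (-(1 / p)) :=
      Real.rpow_le_rpow_of_nonpos (by positivity) h2 (by simp; positivity)

end RealDecay

/-! ### Observability along the nonlinear flow and the decay rate. -/

section Decay

variable {𝕜 H : Type*} [RCLike 𝕜] [NormedAddCommGroup H] [InnerProductSpace 𝕜 H]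
  {S : ℝ → H →L[𝕜] H} {B : H →L[𝕜] H} {r : ℝ}

theorem norm_inner_self_le (B : H →L[𝕜] H) (y : H) : ‖(inner 𝕜 (B y) y : 𝕜)‖ ≤ ‖B‖ * ‖y‖ ^ 2 := by
  have := B.le_opNorm y
  calc _ ≤ ‖B y‖ * ‖y‖ := norm_inner_le_norm _ _
    _ ≤ (‖B‖ * ‖y‖) * ‖y‖ := by gcongr
    _ = _ := by ring

/-- If `b = |⟨By, y⟩|` exceeds `ε M²`, then `‖B‖ ‖y‖² ≥ b` makes `‖y‖` comparable to `M`, so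
`‖y‖^(-r)` may replace `M^(-r)` for either sign of `r`; then use `b ≤ b² / (ε M²)`. -/
theorem exists_norm_inner_le_add_dissipation (B : H →L[𝕜] H) (r : ℝ) {ε : ℝ} (hε : 0 < ε) :
    ∃ C : ℝ, 0 < C ∧ ∀ (y : H) (M : ℝ), 0 < M → ‖y‖ ≤ M → ‖(inner 𝕜 (B y) y : 𝕜)‖ ≤
      ε * M ^ 2 + C * M ^ (r - 2) * (‖y‖ ^ (-r) * ‖(inner 𝕜 (B y) y : 𝕜)‖ ^ 2) := by
  set κ := ‖B‖ / ε + 1 with hκ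
  have hκ0 : 0 < κ := by positivity
  refine ⟨κ ^ (|r| / 2) / ε, by positivity, fun y M hM hy => ?_⟩
  have hb := norm_inner_self_le B y
  have hb0 := norm_nonneg (inner 𝕜 (B y) y : 𝕜)
  set b := ‖(inner 𝕜 (B y) y : 𝕜)‖
  rcases le_or_gt b (ε * M ^ 2) with h | h
  · exact h.trans (le_add_of_nonneg_right (by positivity))
  have hbp : 0 < b := lt_trans (by positivity) h
  have hyp : 0 < ‖y‖ := by
    refine (norm_nonneg y).lt_of_ne fun h0 => ?_
    rw [← h0] at hb
    norm_num at hb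
    linarith
  have hq1 : 1 ≤ M / ‖y‖ := (one_le_div hyp).2 hy
  have hq2 : (M / ‖y‖) ^ 2 ≤ κ := by
    rw [div_pow, div_le_iff₀ (by positivity), hκ]
    have : M ^ 2 ≤ ‖B‖ / ε * ‖y‖ ^ 2 := by
      rw [div_mul_eq_mul_div, le_div_iff₀ hε]; linarith
    nlinarith [sq_nonneg ‖y‖]
  have hq3 : 1 ≤ κ ^ (|r| / 2) * (M / ‖y‖) ^ r := by
    have h1 : (M / ‖y‖) ^ |r| ≤ κ ^ (|r| / 2) := by
      calc (M / ‖y‖) ^ |r| = ((M / ‖y‖) ^ 2) ^ (|r| / 2) := by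
            rw [← Real.rpow_natCast, ← Real.rpow_mul (by positivity)]; congr 1; push_cast; ring
        _ ≤ _ := by gcongr
    calc (1 : ℝ) ≤ (M / ‖y‖) ^ (|r| + r) :=
          Real.one_le_rpow hq1 (by linarith [neg_abs_le r])
      _ = (M / ‖y‖) ^ |r| * (M / ‖y‖) ^ r := Real.rpow_add (by positivity) _ _
      _ ≤ _ := by gcongr
  have e : κ ^ (|r| / 2) / ε * M ^ (r - 2) * (‖y‖ ^ (-r) * b ^ 2) =
      (κ ^ (|r| / 2) * (M / ‖y‖) ^ r) * (b * (b / (ε * M ^ 2))) := by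
    rw [show r - 2 = r - (2 : ℕ) by norm_num, Real.rpow_sub hM, Real.rpow_natCast,
      Real.div_rpow hM.le hyp.le, Real.rpow_neg hyp.le]
    field_simp
  rw [e]
  have h4 : 1 ≤ b / (ε * M ^ 2) := (one_le_div (by positivity)).2 h.le
  have h5 : b ≤ b * (b / (ε * M ^ 2)) := le_mul_of_one_le_right hb0 h4
  have h6 : b * (b / (ε * M ^ 2)) ≤ (κ ^ (|r| / 2) * (M / ‖y‖) ^ r) * (b * (b / (ε * M ^ 2))) :=
    le_mul_of_one_le_left (by positivity) hq3
  have : 0 < ε * M ^ 2 := by positivity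
  linarith

/-- Young's inequality leaves the coefficient `‖y‖^(2-r)`, which is at most `R^(2(2-r)) M^(r-2)`
since `‖y‖ ≤ M ≤ R`. -/
theorem exists_mul_norm_closedLoop_feedback_le (B : H →L[𝕜] H) (hr : r < 2) {ε : ℝ} (hε : 0 < ε)
    (R : ℝ) : ∃ C : ℝ, 0 ≤ C ∧ ∀ (t : ℝ) (y : H) (M : ℝ), 0 < M → M ≤ R → ‖y‖ ≤ M →
      M * ‖closedLoop B (feedback B r) t y‖ ≤
        ε * M ^ 2 + C * M ^ (r - 2) * (‖y‖ ^ (-r) * ‖(inner 𝕜 (B y) y : 𝕜)‖ ^ 2) := by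
  refine ⟨‖B‖ ^ 2 * (R ^ (2 - r)) ^ 2 / (4 * ε), by positivity, fun t y M hM hMR hy => ?_⟩
  rcases eq_or_ne y 0 with rfl | hy0
  · simp [closedLoop_feedback_zero]; positivity
  have hyp : 0 < ‖y‖ := norm_pos_iff.2 hy0
  rw [norm_closedLoop_feedback]
  set b := ‖(inner 𝕜 (B y) y : 𝕜)‖
  set q := ‖y‖ ^ (-r) with hq
  have hq0 : 0 < q := Real.rpow_pos_of_pos hyp _
  have hqy : q * ‖y‖ ^ 2 = ‖y‖ ^ (2 - r) := by
    rw [hq, ← Real.rpow_natCast, ← Real.rpow_add hyp]; congr 1; push_cast; ring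
  have h1 : ‖y‖ ^ (2 - r) ≤ (R ^ (2 - r)) ^ 2 * M ^ (r - 2) := by
    have hMp := Real.rpow_pos_of_pos hM (2 - r)
    have hyM : ‖y‖ ^ (2 - r) ≤ M ^ (2 - r) := Real.rpow_le_rpow hyp.le hy (by linarith)
    have hMR' : M ^ (2 - r) ≤ R ^ (2 - r) := Real.rpow_le_rpow hM.le hMR (by linarith)
    rw [show r - 2 = -(2 - r) by ring, Real.rpow_neg hM.le, ← div_eq_mul_inv, le_div_iff₀ hMp, sq]
    exact mul_le_mul (hyM.trans hMR') hMR' hMp.le (by linarith)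
  have hBy := B.le_opNorm y
  calc M * (q * (b * ‖B y‖)) ≤ M * (q * (b * (‖B‖ * ‖y‖))) := by gcongr
    _ ≤ ε * M ^ 2 + ‖B‖ ^ 2 * (q * ‖y‖ ^ 2) / (4 * ε) * (q * b ^ 2) := by
      have e : ε * M ^ 2 + ‖B‖ ^ 2 * (q * ‖y‖ ^ 2) / (4 * ε) * (q * b ^ 2)
          - M * (q * (b * (‖B‖ * ‖y‖))) = (2 * ε * M - ‖B‖ * q * b * ‖y‖) ^ 2 / (4 * ε) := by
        field_simp; ring
      have : 0 ≤ (2 * ε * M - ‖B‖ * q * b * ‖y‖) ^ 2 / (4 * ε) := by positivity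
      linarith
    _ ≤ ε * M ^ 2 + ‖B‖ ^ 2 * ((R ^ (2 - r)) ^ 2 * M ^ (r - 2)) / (4 * ε) * (q * b ^ 2) := by
      rw [hqy]; gcongr
    _ = _ := by ring

theorem norm_inner_le_norm_inner_add (B : H →L[𝕜] H) {x y : H} {M : ℝ} (hx : ‖x‖ ≤ M)
    (hy : ‖y‖ ≤ M) :
    ‖(inner 𝕜 (B x) x : 𝕜)‖ ≤ ‖(inner 𝕜 (B y) y : 𝕜)‖ + 2 * ‖B‖ * M * ‖y - x‖ := by
  have hM : 0 ≤ M := (norm_nonneg x).trans hx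
  have e : (inner 𝕜 (B x) x : 𝕜) =
      inner 𝕜 (B y) y + (inner 𝕜 (B x) (x - y) + inner 𝕜 (B (x - y)) y) := by
    rw [map_sub, inner_sub_left, inner_sub_right]; ring
  have h1 : ∀ u v : H, ‖(inner 𝕜 (B u) v : 𝕜)‖ ≤ ‖B‖ * ‖u‖ * ‖v‖ := fun u v =>
    (norm_inner_le_norm _ _).trans (by gcongr; exact B.le_opNorm u)
  rw [e, norm_sub_rev y]
  calc _ ≤ ‖(inner 𝕜 (B y) y : 𝕜)‖ + (‖B‖ * ‖x‖ * ‖x - y‖ + ‖B‖ * ‖x - y‖ * ‖y‖) :=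
        (norm_add_le _ _).trans (add_le_add le_rfl
          ((norm_add_le _ _).trans (add_le_add (h1 _ _) (h1 _ _))))
    _ ≤ ‖(inner 𝕜 (B y) y : 𝕜)‖ + (‖B‖ * M * ‖x - y‖ + ‖B‖ * ‖x - y‖ * M) := by gcongr
    _ = _ := by ring

variable [NormedSpace ℝ H] [CompleteSpace H] {z₀ : H} {z : ℝ → H}

/-- Free and forced orbits from `z s` both stay in the ball of radius `‖z s‖` and differ by at most
`∫ ‖f‖`; integrating this over the window produces the factor `T`. -/
theorem IsForcedSolution.observability_le (hS : IsContractionSemigroup S) {f : ℝ → H}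
    (hz : IsForcedSolution S f z₀ z) (hf : ∀ t, RCLike.re (inner 𝕜 (z t) (f t)) ≤ 0)
    {s T : ℝ} (hs : 0 ≤ s) (hT : 0 ≤ T) :
    ∫ t in (0 : ℝ)..T, ‖(inner 𝕜 (B (S t (z s))) (S t (z s)) : 𝕜)‖ ≤
      ∫ t in s..s + T, (‖(inner 𝕜 (B (z t)) (z t) : 𝕜)‖ + 2 * ‖B‖ * T * (‖z s‖ * ‖f t‖)) := by
  have hzc := hz.continuous
  have hfc := hz.continuous_force
  set J := ∫ t in s..s + T, ‖f t‖
  have hSc : Continuous fun t : ℝ => S (max t 0) (z s) := hS.continuous_max _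
  have h1 : ∀ t ∈ Icc 0 T, ‖(inner 𝕜 (B (S t (z s))) (S t (z s)) : 𝕜)‖ ≤
      ‖(inner 𝕜 (B (z (s + t))) (z (s + t)) : 𝕜)‖ + 2 * ‖B‖ * ‖z s‖ * J := by
    intro t ht
    have h2 := norm_inner_le_norm_inner_add (𝕜 := 𝕜) B (hS.norm_le t ht.1 (z s))
      (hz.norm_le_norm hS hf hs (by linarith [ht.1] : s ≤ s + t))
    have h3 := hz.norm_sub_le hS hs (by linarith [ht.1] : s ≤ s + t)
    rw [add_sub_cancel_left] at h3
    have h4 : ∫ τ in s..s + t, ‖f τ‖ ≤ J :=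
      intervalIntegral.integral_mono_interval le_rfl (by linarith [ht.1]) (by linarith [ht.2])
        (Eventually.of_forall fun τ => norm_nonneg _) (hfc.norm.intervalIntegrable _ _)
    refine h2.trans ?_
    gcongr
    exact h3.trans h4
  calc _ ≤ ∫ t in (0 : ℝ)..T, (‖(inner 𝕜 (B (z (s + t))) (z (s + t)) : 𝕜)‖
        + 2 * ‖B‖ * ‖z s‖ * J) := by
        refine intervalIntegral.integral_mono_on hT ?_
          (Continuous.intervalIntegrable (by fun_prop) _ _) h1
        refine ContinuousOn.intervalIntegrable ?_
        have hc : Continuous fun t : ℝ =>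
            ‖(inner 𝕜 (B (S (max t 0) (z s))) (S (max t 0) (z s)) : 𝕜)‖ :=
          ((B.continuous.comp hSc).inner hSc).norm
        refine hc.continuousOn.congr fun t ht => ?_
        rw [uIcc_of_le hT] at ht
        simp only [max_eq_left ht.1]
    _ = _ := by
      have hcb : Continuous fun t => ‖(inner 𝕜 (B (z t)) (z t) : 𝕜)‖ := by fun_prop
      have hcs : Continuous fun t => ‖(inner 𝕜 (B (z (s + t))) (z (s + t)) : 𝕜)‖ := by fun_prop
      rw [intervalIntegral.integral_add (hcs.intervalIntegrable _ _) (by simp),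
        intervalIntegral.integral_add (hcb.intervalIntegrable _ _)
          (Continuous.intervalIntegrable (by fun_prop) _ _),
        intervalIntegral.integral_comp_add_left
          (fun t => ‖(inner 𝕜 (B (z t)) (z t) : 𝕜)‖), intervalIntegral.integral_const,
        intervalIntegral.integral_const_mul, intervalIntegral.integral_const_mul]
      simp [J]; ring

theorem IsForcedSolution.exists_sq_le_sub_mul_rpow (hS : IsContractionSemigroup S) (hr : r < 2)
    {δ T : ℝ} (hδ : 0 < δ) (hT : 0 < T)
    (hobs : ∀ y : H, δ * ‖y‖ ^ 2 ≤ ∫ t in (0 : ℝ)..T, ‖(inner 𝕜 (B (S t y)) (S t y) : 𝕜)‖)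
    (hz : IsForcedSolution S (fun t => closedLoop B (feedback B r) t (z t)) z₀ z) :
    ∃ c : ℝ, 0 < c ∧ ∀ s, 0 ≤ s →
      ‖z (s + T)‖ ^ 2 ≤ ‖z s‖ ^ 2 - c * (‖z s‖ ^ 2) ^ (1 + (2 - r) / 2) := by
  have hdiss : ∀ t, RCLike.re (inner 𝕜 (z t) (closedLoop B (feedback B r) t (z t))) ≤ 0 :=
    fun t => re_inner_closedLoop_feedback_nonpos _ _
  -- Chosen so that the `ε M²` terms integrate over the window to exactly `δ / 2 * M²`.
  set ε := δ / (2 * T * (1 + 2 * ‖B‖ * T)) with hε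
  have hε0 : 0 < ε := by positivity
  obtain ⟨C₁, hC₁, h₁⟩ := exists_norm_inner_le_add_dissipation B r hε0
  obtain ⟨C₂, hC₂, h₂⟩ := exists_mul_norm_closedLoop_feedback_le B hr hε0 ‖z₀‖
  set C := C₁ + 2 * ‖B‖ * T * C₂ with hC
  have hC0 : 0 < C := by positivity
  refine ⟨δ / C, by positivity, fun s hs => ?_⟩
  have hsT : s ≤ s + T := by linarith
  have hanti := hz.norm_le_norm hS hdiss hs hsT
  rcases (norm_nonneg (z s)).eq_or_lt' with h0 | hM
  · rw [h0] at hanti ⊢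
    have : ‖z (s + T)‖ = 0 := le_antisymm hanti (norm_nonneg _)
    rw [this, zero_pow two_ne_zero, Real.zero_rpow (by linarith)]
    simp
  have hMR := hz.norm_le_initial hS hdiss hs
  have hzc := hz.continuous
  have hfc := hz.continuous_force
  set M := ‖z s‖
  set D : ℝ → ℝ := fun t => ‖z t‖ ^ (-r) * ‖(inner 𝕜 (B (z t)) (z t) : 𝕜)‖ ^ 2 with hD
  have hre : ∀ t, RCLike.re (inner 𝕜 (z t) (closedLoop B (feedback B r) t (z t))) = -D t :=
    fun t => re_inner_closedLoop_feedback t (z t)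
  have hDc : Continuous D := by
    have : D = fun t => -RCLike.re (inner 𝕜 (z t) (closedLoop B (feedback B r) t (z t))) := by
      funext t; rw [hre, neg_neg]
    rw [this]; fun_prop
  have henergy : 2 * ∫ t in s..s + T, D t ≤ M ^ 2 - ‖z (s + T)‖ ^ 2 := by
    have := hz.energy_le hS hs hsT
    simp only [hre, mul_neg] at this
    rw [intervalIntegral.integral_neg, intervalIntegral.integral_const_mul] at this
    linarith
  have hmain : δ * M ^ 2 ≤ δ / 2 * M ^ 2 + C * M ^ (r - 2) * ∫ t in s..s + T, D t := by
    calc _ ≤ _ := hobs (z s)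
      _ ≤ _ := hz.observability_le hS hdiss hs hT.le
      _ ≤ ∫ t in s..s + T, ((1 + 2 * ‖B‖ * T) * (ε * M ^ 2) + C * M ^ (r - 2) * D t) := by
        refine intervalIntegral.integral_mono_on hsT
          (Continuous.intervalIntegrable (by fun_prop) _ _)
          (Continuous.intervalIntegrable (by fun_prop) _ _) fun t ht => ?_
        have hzt : ‖z t‖ ≤ M := hz.norm_le_norm hS hdiss hs ht.1
        have h3 := h₁ (z t) M hM hzt
        have h4 := mul_le_mul_of_nonneg_left (h₂ t (z t) M hM hMR hzt)
          (by positivity : 0 ≤ 2 * ‖B‖ * T)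
        simp only [hC, hD]
        linarith
      _ = _ := by
        rw [intervalIntegral.integral_add (by simp) ((hDc.const_mul _).intervalIntegrable _ _),
          intervalIntegral.integral_const, intervalIntegral.integral_const_mul, smul_eq_mul, hε]
        congr 1
        field_simp
        ring
  have hMp : M ^ (r - 2) * (M ^ 2) ^ (1 + (2 - r) / 2) = M ^ 2 := by
    rw [← Real.rpow_natCast, ← Real.rpow_mul hM.le, ← Real.rpow_add hM]
    congr 1; push_cast; ring
  have hMr := Real.rpow_pos_of_pos hM (r - 2)
  have h5 : δ * M ^ 2 ≤ C * M ^ (r - 2) * (M ^ 2 - ‖z (s + T)‖ ^ 2) := by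
    have := mul_le_mul_of_nonneg_left henergy (by positivity : 0 ≤ C * M ^ (r - 2))
    linarith
  have h6 : δ / C * (M ^ 2) ^ (1 + (2 - r) / 2) ≤ M ^ 2 - ‖z (s + T)‖ ^ 2 := by
    refine le_of_mul_le_mul_left ?_ (by positivity : 0 < C * M ^ (r - 2))
    calc _ = δ * (M ^ (r - 2) * (M ^ 2) ^ (1 + (2 - r) / 2)) := by field_simp
      _ = δ * M ^ 2 := by rw [hMp]
      _ ≤ _ := h5
  linarith

theorem IsMildSolution.isBigO_norm_of_closedLoop_feedback (hS : IsContractionSemigroup S)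
    (hr : r < 2)
    (hobs : ∃ δ T : ℝ, 0 < δ ∧ 0 < T ∧ ∀ y : H,
      δ * ‖y‖ ^ 2 ≤ ∫ t in (0 : ℝ)..T, ‖(inner 𝕜 (B (S t y)) (S t y) : 𝕜)‖)
    (hz : IsMildSolution S (closedLoop B (feedback B r)) z₀ z) :
    (fun t : ℝ => ‖z t‖) =O[atTop] fun t : ℝ => t ^ (-(1 / (2 - r))) := by
  obtain ⟨δ, T, hδ, hT, hobs⟩ := hobs
  have hz' := IsMildSolution.isForcedSolution
    (continuous_closedLoop_feedback (B := B) (𝕜 := 𝕜) hr 0) hz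
  obtain ⟨c, hc, h⟩ := hz'.exists_sq_le_sub_mul_rpow hS hr hδ hT hobs
  refine (isBigO_rpow_of_sq_le_sub_mul_rpow hT hc (by linarith : 0 < 2 - r)
    (fun t => norm_nonneg (z (max t 0)))
    (fun s t hs hst => hz'.norm_le_norm hS
      (fun t => re_inner_closedLoop_feedback_nonpos 0 _) hs hst) h).congr' ?_ EventuallyEq.rfl
  filter_upwards [eventually_ge_atTop 0] with t ht
  rw [max_eq_left ht]

theorem IsMildSolution.norm_le_of_closedLoop_feedback (hS : IsContractionSemigroup S)
    (hr : r < 2) (hz : IsMildSolution S (closedLoop B (feedback B r)) z₀ z) {t : ℝ} (ht : 0 ≤ t) :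
    ‖z t‖ ≤ ‖z₀‖ := by
  have hz' := IsMildSolution.isForcedSolution
    (continuous_closedLoop_feedback (B := B) (𝕜 := 𝕜) hr 0) hz
  have := hz'.norm_le_initial hS (fun t => re_inner_closedLoop_feedback_nonpos 0 _) ht
  rwa [max_eq_left ht] at this

end Decay
end

theorem mainTheorem1 {𝕜 H : Type*} [RCLike 𝕜] [NormedAddCommGroup H] [InnerProductSpace 𝕜 H]
    [NormedSpace ℝ H] [CompleteSpace H]
    (A : H →ₗ.[𝕜] H) (S : ℝ → H →L[𝕜] H) (B : H →L[𝕜] H)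
    (hS : IsContractionSemigroup S) (hA : IsGenerator A S)
    (hobs : ∃ δ T : ℝ, 0 < δ ∧ 0 < T ∧ ∀ y : H,
      δ * ‖y‖ ^ 2 ≤ ∫ t in (0 : ℝ)..T, ‖inner 𝕜 (B (S t y)) (S t y)‖)
    (r : ℝ) (hr : r < 2) :
    StronglyStabilizes S B (feedback B r) ∧
      ∀ (z₀ : H) (z : ℝ → H), IsMildSolution S (closedLoop B (feedback B r)) z₀ z →
        (fun t : ℝ => ‖z t‖) =O[atTop] (fun t : ℝ => t ^ (-(1 / (2 - r)))) := by
  have hrate : ∀ (z₀ : H) (z : ℝ → H), IsMildSolution S (closedLoop B (feedback B r)) z₀ z →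
      (fun t : ℝ => ‖z t‖) =O[atTop] (fun t : ℝ => t ^ (-(1 / (2 - r)))) :=
    fun z₀ z hz => hz.isBigO_norm_of_closedLoop_feedback hS hr hobs
  refine ⟨⟨fun z₀ => exists_isMildSolution_closedLoop_feedback hS hr z₀,
    fun z₀ z w hz hw => hz.eqOn_of_closedLoop_feedback hS hr hw,
    -- Norms never exceed `‖z₀‖`, so `α = ε` works.
    fun ε hε => ⟨ε, hε, fun z₀ z hz h t ht =>
      (hz.norm_le_of_closedLoop_feedback hS hr ht).trans_lt h⟩, fun z₀ z hz => ?_⟩, hrate⟩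
  exact tendsto_zero_iff_norm_tendsto_zero.2 ((hrate z₀ z hz).trans_tendsto
    (tendsto_rpow_neg_atTop (one_div_pos.2 (by linarith))))
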